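/- Let $M\cong\mathbb Z^d$ be a lattice with dual lattice $N$. Let $K\subset M_{\mathbb R}$ be a reflexive Gorenstein cone: $K$ and its dual cone $K^\vee\subset N_{\mathbb R}$ are full-dimensional, strongly convex rational polyhedral cones, and there are degree elements $\deg^\vee\in N$ and $\deg\in M$ such that $\langle m,\deg^\vee\rangle=1$ for the primitive generator $m$ of every ray of $K$ and $\langle\deg,n\rangle=1$ for the primitive generator $n$ of every ray of $K^\vee$. Put $k=\langle\deg,\deg^\vee\rangle$, $K_{(1)}=\{m\in K\cap M:\langle m,\deg^\vee\rangle=1\}$ and $K^\vee_{(1)}=\{n\in K^\vee\cap N:\langle\deg,n\rangle=1\}$; these two sets are finite. Let $0\le r\le k$ and let $\deg^\vee=\tfrac12(s_1+\dots+s_{2r})+t_1+\dots+t_{k-r}$, where $s_i,t_j\in K^\vee\cap N$ are linearly independent. Let $\Sigma$ be a simplicial fan with support $K^\vee$ whose rays are generated by elements of $K^\vee_{(1)}$, which is regular as a triangulation of the vector configuration $K^\vee_{(1)}$, and such that every cone of $\Sigma$ of maximal dimension $d$ has all the $s_i$ and $t_j$ among its ray generators. Let $U_{\overline\Sigma}\subset\mathbb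 C^{K^\vee_{(1)}-\{s_i,t_j\}}$ be the Cox open subset of those $\mathbf z$ for which $\{n:\mathbf z(n)=0\}\cup\{s_1,\dots,s_{2r},t_1,\dots,t_{k-r}\}$ is the set of ray generators of a cone of $\Sigma$. For a coefficient function $c:K_{(1)}\to\mathbb C$ and $1\le i\le k-r$ let $$f_i=\sum_{m\in K_{(1)},\ \langle m,t_i\rangle=1}c(m)\prod_{n\in K^\vee_{(1)}-\{s_j,t_l\}}\mathbf z(n)^{\langle m,n\rangle}.$$ Proposition. For a general coefficient function $c$, that is, for all $c$ in some nonempty Zariski open subset of $\mathbb C^{K_{(1)}}$, the section $f=(f_1,\dots,f_{k-r})$ of the trivial bundle of rank $k-r$ is regular on $U_{\overline\Sigma}$: its zero locus $Y=\bigcap_{i=1}^{k-r}\{f_i=0\}\subset U_{\overline\Sigma}$ is a complete intersection of codimension $k-r$, i.e. every irreducible component of $Y$ has codimension $k-r$ in $U_{\overline\Sigma}$ (the empty set is allowed as a $Y$). -/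

import Mathlib

namespace CliffordMirror

/-! ### Lattices and cones

The lattice `M` is `ℤ ^ d`, its dual lattice `N` is again `ℤ ^ d`, and the pairing of `M` and `N`
is the dot product; `M_ℝ` and `N_ℝ` are `ℝ ^ d`. -/

/-- The inclusion of the lattice `ℤ ^ d` in `ℝ ^ d`. -/
def toReal {d : ℕ} (v : Fin d → ℤ) : Fin d → ℝ := fun j => (v j : ℝ)

/-- The dual cone `{y | ⟨x, y⟩ ≥ 0 for all x ∈ K}`. -/
def dualCone {d : ℕ} (K : PointedCone ℝ (Fin d → ℝ)) : PointedCone ℝ (Fin d → ℝ) :=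
  PointedCone.dual (dotProductBilin ℝ ℝ) (K : Set (Fin d → ℝ))

/-- A rational polyhedral cone: generated by finitely many lattice points, and containing
no line. -/
structure IsRationalPolyhedral {d : ℕ} (K : PointedCone ℝ (Fin d → ℝ)) : Prop where
  exists_generators : ∃ S : Finset (Fin d → ℤ), K = PointedCone.hull ℝ (toReal '' (S : Set _))
  eq_zero : ∀ x ∈ K, -x ∈ K → x = 0

/-- `v` is the primitive element of a ray (one-dimensional face) of `K`: it spans a ray of `K`,
and it is the first lattice point on it. -/
structure IsPrimitiveRayGenerator {d : ℕ} (K : PointedCone ℝ (Fin d → ℝ)) (v : Fin d → ℤ) :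
    Prop where
  mem : toReal v ∈ K
  ne_zero : v ≠ 0
  extreme : ∀ x ∈ K, ∀ y ∈ K, x + y = toReal v → ∃ a : ℝ, 0 ≤ a ∧ x = a • toReal v
  first : ∀ (w : Fin d → ℤ) (a : ℝ), 0 < a → toReal w = a • toReal v → 1 ≤ a

/-- `K` is a Gorenstein cone with degree element `e` (an element of the dual lattice). -/
structure IsGorensteinCone {d : ℕ} (K : PointedCone ℝ (Fin d → ℝ)) (e : Fin d → ℤ) : Prop where
  rational : IsRationalPolyhedral K
  full_dim : Submodule.span ℝ (K : Set (Fin d → ℝ)) = ⊤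
  degree : ∀ v, IsPrimitiveRayGenerator K v → v ⬝ᵥ e = 1

/-- The set `K_(1)` of the lattice points of `K` of degree `1` for the degree element `e`. -/
def degreeOne {d : ℕ} (K : PointedCone ℝ (Fin d → ℝ)) (e : Fin d → ℤ) : Set (Fin d → ℤ) :=
  {m | toReal m ∈ K ∧ m ⬝ᵥ e = 1}

/-- A reflexive Gorenstein cone `K` in `M_ℝ`, with `degv` in `N` the degree element of `K` and
`deg` in `M` the degree element of the dual cone. -/
structure ReflexivePair (d : ℕ) where
  K : PointedCone ℝ (Fin d → ℝ)
  deg : Fin d → ℤ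
  degv : Fin d → ℤ
  gorenstein : IsGorensteinCone K degv
  gorenstein_dual : IsGorensteinCone (dualCone K) deg

namespace ReflexivePair

variable {d : ℕ} (P : ReflexivePair d)

/-- `K_(1)`, a subset of `M`. -/
def K1 : Set (Fin d → ℤ) := degreeOne P.K P.degv

/-- `K^∨_(1)`, a subset of `N`. -/
def Kv1 : Set (Fin d → ℤ) := degreeOne (dualCone P.K) P.deg

end ReflexivePair

/-! ### Finiteness of the sets of lattice points of degree one -/

theorem toReal_dotProduct {d : ℕ} (v w : Fin d → ℤ) :
    toReal v ⬝ᵥ toReal w = ((v ⬝ᵥ w : ℤ) : ℝ) := by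
  simp [toReal, dotProduct]

theorem toReal_injective {d : ℕ} : Function.Injective (toReal (d := d)) := by
  intro v w h
  funext j
  have := congrFun h j
  simpa [toReal] using this

/-- A rational polyhedral cone is generated by nonzero lattice points that span rays of it. -/
theorem IsRationalPolyhedral.exists_extreme {d : ℕ} {K : PointedCone ℝ (Fin d → ℝ)}
    (hK : IsRationalPolyhedral K) :
    ∃ S : Finset (Fin d → ℤ), K = PointedCone.hull ℝ (toReal '' (S : Set _)) ∧
      ∀ v ∈ S, v ≠ 0 ∧ ∀ x ∈ K, ∀ y ∈ K, x + y = toReal v →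
        ∃ a : ℝ, 0 ≤ a ∧ x = a • toReal v := by
  classical
  have hex : ∃ n : ℕ, ∃ S : Finset (Fin d → ℤ), S.card = n ∧
      K = PointedCone.hull ℝ (toReal '' (S : Set _)) := by
    obtain ⟨S, hS⟩ := hK.exists_generators
    exact ⟨_, S, rfl, hS⟩
  obtain ⟨S, hcard, hS⟩ := Nat.find_spec hex
  refine ⟨S, hS, fun v hv => ?_⟩
  -- By minimality, no element of `S` lies in the cone generated by the others.
  have hmin : toReal v ∉ PointedCone.hull ℝ (toReal '' ((S.erase v : Finset _) : Set _)) := by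
    intro hmem
    have hlt : (S.erase v).card < Nat.find hex := by
      rw [← hcard]; exact Finset.card_erase_lt_of_mem hv
    apply Nat.find_min hex hlt
    refine ⟨_, rfl, le_antisymm ?_ ?_⟩
    · rw [hS]
      apply Submodule.span_le.2
      rintro _ ⟨w, hw, rfl⟩
      by_cases hwv : w = v
      · subst hwv; exact hmem
      · exact Submodule.subset_span ⟨w, by simpa [hwv] using hw, rfl⟩
    · rw [hS]
      apply Submodule.span_mono
      apply Set.image_mono
      exact_mod_cast Finset.erase_subset v S
  have hdecomp : ∀ x ∈ K, ∃ a : ℝ, 0 ≤ a ∧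
      ∃ x' ∈ PointedCone.hull ℝ (toReal '' ((S.erase v : Finset _) : Set _)),
        x = a • toReal v + x' := by
    intro x hx
    rw [hS] at hx
    have hins : toReal '' (S : Set (Fin d → ℤ)) =
        insert (toReal v) (toReal '' ((S.erase v : Finset _) : Set _)) := by
      rw [← Set.image_insert_eq, ← Finset.coe_insert, Finset.insert_erase hv]
    rw [hins] at hx
    obtain ⟨a, z, hz, hxz⟩ := Submodule.mem_span_insert.1 hx
    exact ⟨a, a.2, z, hz, hxz⟩
  have hsub : ∀ x ∈ PointedCone.hull ℝ (toReal '' ((S.erase v : Finset _) : Set _)), x ∈ K := by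
    intro x hx
    rw [hS]
    refine Submodule.span_mono (Set.image_mono ?_) hx
    exact_mod_cast Finset.erase_subset v S
  have hvK : toReal v ∈ K := by
    rw [hS]; exact Submodule.subset_span ⟨v, hv, rfl⟩
  refine ⟨?_, ?_⟩
  · rintro rfl
    apply hmin
    have : toReal (0 : Fin d → ℤ) = 0 := by funext j; simp [toReal]
    rw [this]
    exact Submodule.zero_mem _
  · intro x hx y hy hxy
    obtain ⟨a, ha, x', hx', hxe⟩ := hdecomp x hx
    obtain ⟨b, hb, y', hy', hye⟩ := hdecomp y hy
    have hsum : (a • toReal v + x') + (b • toReal v + y') = toReal v := by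
      rw [← hxe, ← hye]; exact hxy
    have hrel : x' + y' = (1 - a - b) • toReal v := by
      have h3 : x' + y' = toReal v - a • toReal v - b • toReal v := by
        linear_combination (exp := 1) hsum
      rw [h3]
      module
    rcases lt_or_ge 0 (1 - a - b) with hpos | hneg
    · exfalso
      apply hmin
      have h1 : toReal v = (⟨(1 - a - b)⁻¹, (inv_pos.2 hpos).le⟩ : {c : ℝ // 0 ≤ c}) •
          (x' + y') := by
        change toReal v = (1 - a - b)⁻¹ • (x' + y')
        rw [hrel, smul_smul, inv_mul_cancel₀ hpos.ne', one_smul]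
      rw [h1]
      exact Submodule.smul_mem _ _ (Submodule.add_mem _ hx' hy')
    · have h0 : x' + y' = 0 := by
        apply hK.eq_zero _ (K.add_mem (hsub _ hx') (hsub _ hy'))
        have h2 : -(x' + y') = (⟨a + b - 1, by linarith⟩ : {c : ℝ // 0 ≤ c}) • toReal v := by
          change -(x' + y') = (a + b - 1) • toReal v
          rw [hrel, ← neg_smul]
          congr 1
          ring
        rw [h2]
        exact Submodule.smul_mem _ _ hvK
      have hx0 : x' = 0 := by
        apply hK.eq_zero _ (hsub _ hx')
        rw [neg_eq_of_add_eq_zero_right h0]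
        exact hsub _ hy'
      exact ⟨a, ha, by rw [hxe, hx0, add_zero]⟩

/-- On a ray that contains a nonzero lattice point there is a first lattice point. -/
theorem exists_primitive {d : ℕ} {K : PointedCone ℝ (Fin d → ℝ)} {v : Fin d → ℤ}
    (hvK : toReal v ∈ K) (hv : v ≠ 0)
    (hext : ∀ x ∈ K, ∀ y ∈ K, x + y = toReal v → ∃ a : ℝ, 0 ≤ a ∧ x = a • toReal v) :
    ∃ w : Fin d → ℤ, IsPrimitiveRayGenerator K w ∧
      ∃ a : ℝ, 0 < a ∧ toReal v = a • toReal w := by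
  classical
  obtain ⟨j, hj⟩ : ∃ j, v j ≠ 0 := by
    by_contra! h
    exact hv (funext h)
  have hex : ∃ n : ℕ, ∃ w : Fin d → ℤ, (w j).natAbs = n ∧
      ∃ a : ℝ, 0 < a ∧ toReal w = a • toReal v := ⟨_, v, rfl, 1, one_pos, by simp⟩
  obtain ⟨w, hw, a, ha, hwa⟩ := Nat.find_spec hex
  have hinv : toReal v = a⁻¹ • toReal w := by
    rw [hwa, smul_smul, inv_mul_cancel₀ ha.ne', one_smul]
  have hwj : w j ≠ 0 := by
    intro h0
    have h1 := congrFun hwa j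
    simp only [toReal, Pi.smul_apply, smul_eq_mul, h0, Int.cast_zero] at h1
    rcases mul_eq_zero.1 h1.symm with h | h
    · exact ha.ne' h
    · exact hj (by exact_mod_cast h)
  refine ⟨w, ⟨?_, ?_, ?_, ?_⟩, a⁻¹, inv_pos.2 ha, hinv⟩
  · rw [hwa]
    exact K.smul_mem ha.le hvK
  · rintro rfl
    exact hwj rfl
  · intro x hx y hy hxy
    have hscale : ∀ z ∈ K, a⁻¹ • z ∈ K := fun z hz =>
      K.smul_mem (inv_pos.2 ha).le hz
    obtain ⟨b, hb, hxb⟩ := hext _ (hscale x hx) _ (hscale y hy)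
      (by rw [← smul_add, hxy, ← hinv])
    refine ⟨b, hb, ?_⟩
    rw [hwa, smul_comm b a, ← hxb, smul_smul, mul_inv_cancel₀ ha.ne', one_smul]
  · intro u b hb hub
    have hle : (w j).natAbs ≤ (u j).natAbs := by
      rw [hw]
      exact Nat.find_min' hex ⟨u, rfl, b * a, mul_pos hb ha, by rw [hub, hwa, smul_smul]⟩
    have hle' : |(w j : ℝ)| ≤ |(u j : ℝ)| := by
      have h3 : |w j| ≤ |u j| := by
        rw [Int.abs_eq_natAbs, Int.abs_eq_natAbs]; exact_mod_cast hle
      exact_mod_cast h3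
    have huj : (u j : ℝ) = b * w j := congrFun hub j
    have hpos : 0 < |(w j : ℝ)| := abs_pos.2 (by exact_mod_cast hwj)
    rw [huj, abs_mul, abs_of_pos hb] at hle'
    nlinarith

theorem IsGorensteinCone.finite_degreeOne {d : ℕ} {K : PointedCone ℝ (Fin d → ℝ)}
    {e : Fin d → ℤ} (h : IsGorensteinCone K e) : (degreeOne K e).Finite := by
  obtain ⟨S, hS, hext⟩ := h.rational.exists_extreme
  have hpos : ∀ v ∈ S, 0 < toReal v ⬝ᵥ toReal e := by
    intro v hv
    have hvK : toReal v ∈ K := by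
      rw [hS]; exact Submodule.subset_span ⟨v, hv, rfl⟩
    obtain ⟨w, hw, a, ha, hva⟩ := exists_primitive hvK (hext v hv).1 (hext v hv).2
    rw [hva, smul_dotProduct, toReal_dotProduct, h.degree w hw]
    simpa using ha
  obtain ⟨B, hB⟩ : ∃ B : ℕ, ∀ v ∈ S, ∀ j, |toReal v j| ≤ B * (toReal v ⬝ᵥ toReal e) := by
    obtain ⟨B, hB⟩ := exists_nat_ge
      (∑ v ∈ S, ∑ j, |toReal v j| / (toReal v ⬝ᵥ toReal e))
    refine ⟨B, fun v hv j => ?_⟩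
    rw [← div_le_iff₀ (hpos v hv)]
    refine le_trans ?_ hB
    have hnn : ∀ u ∈ S, ∀ i, 0 ≤ |toReal u i| / (toReal u ⬝ᵥ toReal e) :=
      fun u hu i => div_nonneg (abs_nonneg _) (hpos u hu).le
    refine le_trans ?_ (Finset.single_le_sum
      (f := fun u => ∑ i, |toReal u i| / (toReal u ⬝ᵥ toReal e))
      (fun u hu => Finset.sum_nonneg fun i _ => hnn u hu i) hv)
    exact Finset.single_le_sum (f := fun i => |toReal v i| / (toReal v ⬝ᵥ toReal e))
      (fun i _ => hnn v hv i) (Finset.mem_univ j)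
  have hall : ∀ x ∈ K, ∀ j, |x j| ≤ B * (x ⬝ᵥ toReal e) := by
    intro x hx
    rw [hS] at hx
    induction hx using Submodule.span_induction with
    | mem x hx => obtain ⟨v, hv, rfl⟩ := hx; exact hB v hv
    | zero => intro j; simp
    | add x y _ _ hx hy =>
      intro j
      rw [add_dotProduct, mul_add]
      exact (abs_add_le _ _).trans (add_le_add (hx j) (hy j))
    | smul a x _ hx =>
      intro j
      have h1 : (a • x) = (a : ℝ) • x := rfl
      rw [h1, smul_dotProduct, Pi.smul_apply, smul_eq_mul, smul_eq_mul, abs_mul,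
        abs_of_nonneg a.2]
      have := mul_le_mul_of_nonneg_left (hx j) a.2
      linarith
  refine (Set.finite_Icc (fun _ : Fin d => -(B : ℤ)) (fun _ => (B : ℤ))).subset ?_
  rintro m ⟨hmK, hm⟩
  have hb : ∀ j, |m j| ≤ (B : ℤ) := by
    intro j
    have h1 := hall _ hmK j
    rw [toReal_dotProduct, hm] at h1
    simp only [toReal, Int.cast_one, mul_one] at h1
    exact_mod_cast h1
  exact ⟨fun j => (abs_le.1 (hb j)).1, fun j => (abs_le.1 (hb j)).2⟩

noncomputable section

namespace ReflexivePair

variable {d : ℕ} (P : ReflexivePair d)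

instance : Fintype P.K1 := P.gorenstein.finite_degreeOne.fintype

instance : Fintype P.Kv1 := P.gorenstein_dual.finite_degreeOne.fintype

end ReflexivePair

/-! ### Simplicial fans -/

/-- The cone in `N_ℝ` generated by a finite set of lattice points. -/
def coneOf {d : ℕ} (σ : Finset (Fin d → ℤ)) : PointedCone ℝ (Fin d → ℝ) :=
  PointedCone.hull ℝ (toReal '' (σ : Set (Fin d → ℤ)))

/-- A simplicial fan in `N_ℝ` whose rays are generated by elements of `A`. A cone of the fan is
given by the set of its ray generators. (In the application `A = K^∨_(1)`, whose elements are
primitive and span pairwise different rays, so that a cone and the set of its ray generators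
determine each other.) -/
structure SimplicialFan {d : ℕ} (A : Set (Fin d → ℤ)) where
  cells : Set (Finset (Fin d → ℤ))
  subset_rays : ∀ σ ∈ cells, ∀ n ∈ σ, n ∈ A
  simplicial : ∀ σ ∈ cells, LinearIndependent ℝ (fun n : σ => toReal (n : Fin d → ℤ))
  face_mem : ∀ σ ∈ cells, ∀ τ ⊆ σ, τ ∈ cells
  inter_eq : ∀ σ ∈ cells, ∀ τ ∈ cells,
    (coneOf σ : Set (Fin d → ℝ)) ∩ coneOf τ = coneOf (σ ∩ τ)

namespace SimplicialFan

variable {d : ℕ} {A : Set (Fin d → ℤ)} (F : SimplicialFan A)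

/-- The support of the fan, the union of its cones. -/
def support : Set (Fin d → ℝ) := ⋃ σ ∈ F.cells, (coneOf σ : Set (Fin d → ℝ))

/-- The fan is regular (coherent), as a triangulation of the vector configuration `A`: there are
weights on `A` such that every cone of maximal dimension consists of the elements of `A` at which
some linear function attains its weight, and this function is below the weights elsewhere
on `A`. -/
def IsRegular : Prop :=
  ∃ ω : (Fin d → ℤ) → ℝ, ∀ σ ∈ F.cells, σ.card = d →
    ∃ x : Fin d → ℝ, (∀ n ∈ σ, x ⬝ᵥ toReal n = ω n) ∧ ∀ n ∈ A, n ∉ σ → x ⬝ᵥ toReal n < ω n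

end SimplicialFan

/-! ### The combinatorial data of a general Clifford mirror -/

/-- A decomposition `deg^∨ = (s_1 + ⋯ + s_{2r}) / 2 + t_1 + ⋯ + t_{k-r}`, where `k` is the index
of the pair, together with a regular simplicial fan with support `K^∨` that satisfies the
centrality condition. -/
structure CliffordDatum {d : ℕ} (P : ReflexivePair d) (k r : ℕ) where
  index_eq : P.deg ⬝ᵥ P.degv = k
  r_le : r ≤ k
  s : Fin (2 * r) → Fin d → ℤ
  t : Fin (k - r) → Fin d → ℤ
  s_mem : ∀ i, toReal (s i) ∈ dualCone P.K
  t_mem : ∀ i, toReal (t i) ∈ dualCone P.K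
  decomposition :
    toReal P.degv = (1 / 2 : ℝ) • ∑ i, toReal (s i) + ∑ i, toReal (t i)
  linearIndependent : LinearIndependent ℝ (Sum.elim (fun i => toReal (s i)) fun i => toReal (t i))
  fan : SimplicialFan P.Kv1
  regular : fan.IsRegular
  support_eq : fan.support = dualCone P.K
  centrality : ∀ σ ∈ fan.cells, σ.card = d → (∀ i, s i ∈ σ) ∧ ∀ i, t i ∈ σ

namespace CliffordDatum

variable {d : ℕ} {P : ReflexivePair d} {k r : ℕ} (D : CliffordDatum P k r)

/-- The index set `K^∨_(1) - {s_i, t_j}` of the coordinates of the affine space that contains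
`U_Σ̄`. -/
def Coord : Type :=
  {n : P.Kv1 // (n : Fin d → ℤ) ∉ Set.range D.s ∧ (n : Fin d → ℤ) ∉ Set.range D.t}

instance : Fintype D.Coord := by
  classical
  unfold Coord
  infer_instance

/-- The element of `N` that indexes a coordinate. -/
def Coord.val {D : CliffordDatum P k r} (n : D.Coord) : Fin d → ℤ := n.1

/-- The coordinate ring of the affine space `ℂ ^ (K^∨_(1) - {s_i, t_j})`. -/
abbrev CoordRing : Type := MvPolynomial D.Coord ℂ

/-- The Cox open subset `U_Σ̄` of `ℂ ^ (K^∨_(1) - {s_i, t_j})`, as an open subset of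
the spectrum of the coordinate ring. It consists of the points at which the set of the vanishing
coordinates is a cone of `Σ̄`. The cones of `Σ̄` are the images of the cones of `Σ` that contain
all `s_i` and `t_j`; so the condition is that the vanishing coordinates, together with the
`s_i` and `t_j`, are the ray generators of a cone of `Σ`. -/
def coxOpen : Set (PrimeSpectrum D.CoordRing) :=
  {p | ∃ σ ∈ D.fan.cells, (σ : Set (Fin d → ℤ)) =
    (Coord.val '' {n : D.Coord | (MvPolynomial.X n : D.CoordRing) ∈ p.asIdeal}) ∪
      (Set.range D.s ∪ Set.range D.t)}

/-- The polynomial `f_i = ∑ c(m) ∏ z(n) ^ ⟨m, n⟩`, where the sum is over the `m` in `K_(1)` with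
`⟨m, t_i⟩ = 1` and the product over the `n` in `K^∨_(1) - {s_i, t_j}`. The exponents are
nonnegative, as `m` is in `K` and `n` in `K^∨`. -/
def f (c : P.K1 → ℂ) (i : Fin (k - r)) : D.CoordRing :=
  ∑ m ∈ Finset.univ.filter (fun m : P.K1 => m.1 ⬝ᵥ D.t i = 1),
    MvPolynomial.C (c m) *
      ∏ n : D.Coord, MvPolynomial.X n ^ (m.1 ⬝ᵥ n.val).toNat

end CliffordDatum

/-! ### Regular sections -/

/-- A closed subset `Y` of the space `X` has pure codimension `c`: all its irreducible components
have codimension `c` in `X`. Here the codimension of an irreducible closed subset `Z` is the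
supremum of the lengths of the chains `Z = Z_0 ⊂ Z_1 ⊂ ⋯` of irreducible closed subsets
of `X`. -/
def HasPureCodim {X : Type*} [TopologicalSpace X] (Y : Set X) (c : ℕ) : Prop :=
  IsClosed Y ∧ ∀ Z : TopologicalSpace.IrreducibleCloseds X,
    Maximal (fun W : TopologicalSpace.IrreducibleCloseds X => (W : Set X) ⊆ Y) Z →
      Order.coheight Z = c

/-- The common zero locus in `U` of finitely many functions on an affine scheme, for a subset
`U` of the scheme. -/
def zeroLocusIn {R : Type*} [CommRing R] (U : Set (PrimeSpectrum R)) {l : ℕ} (f : Fin l → R) :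
    Set U :=
  {p | ∀ i, f i ∈ p.1.asIdeal}

/-- The section `f = (f_1, …, f_l)` of the trivial bundle of rank `l` is regular on `U`: its
zero locus has codimension `l` in `U`. -/
def IsRegularSection {R : Type*} [CommRing R] (U : Set (PrimeSpectrum R)) {l : ℕ}
    (f : Fin l → R) : Prop :=
  HasPureCodim (zeroLocusIn U f) l

end

end CliffordMirror

/-! The argument is a dimension count on torus orbits. Let `p` be a prime in the Cox open subset
that contains all `f_i`, and let `I` be the set of variables in `p`, so that the generic point of
`V(p)` lies on the torus orbit of `I`. Two facts of convex geometry control the restrictions of the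
`f_i` to this orbit. Pairing the decomposition of `deg^∨` with `m ∈ K_(1)` shows that at most one
`t_i` has `⟨m, t_i⟩ = 1`, so different `f_i` have disjoint sets of coefficients
(`eq_of_dotProduct_t_eq_one`). Centrality shows that each `f_i` keeps a monomial on the orbit
(`exists_mem_K1`).

Hence each equation can be solved for a coefficient of its own, whose monomial is invertible on the
torus. The incidence variety of coefficients and solutions is therefore rational, of dimension the
number of coefficients plus the dimension of the torus minus `k - r`. Too many coordinates satisfy a
relation over the coefficients, and this relation stays nontrivial for general `c`
(`exists_generic_relation`). So the residue ring of `p` has transcendence degree at most `|Coord| -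
|I| - (k - r)`, and `HasDimensionBound.mvPolynomial` turns this into `height p ≥ k - r`. For the
primes of the components of `Y`, Krull's height theorem gives the opposite inequality
(`isRegularSection_of_le_height`). -/

/-! ### Dimension theory: height and transcendence degree in polynomial rings -/

/-- Every prime `p` of the `k`-algebra `A` satisfies `n ≤ trdeg (A ⧸ p) + height p`. -/
def HasDimensionBound (k A : Type) [Field k] [CommRing A] [Algebra k A] (n : ℕ) : Prop :=
  ∀ p : Ideal A, p.IsPrime → ∃ e : ℕ, (e : Cardinal) ≤ Algebra.trdeg k (A ⧸ p) ∧
    (n : ℕ∞) ≤ e + p.height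

namespace HasDimensionBound

variable {k A B : Type} [Field k] [CommRing A] [Algebra k A] [CommRing B] [Algebra k B] {n : ℕ}

theorem trdeg_quotient_comap_le (f : A →ₐ[k] B) (p : Ideal B) :
    Algebra.trdeg k (A ⧸ p.comap f) ≤ Algebra.trdeg k (B ⧸ p) := by
  refine trdeg_le_of_injective (Ideal.quotientMapₐ p f le_rfl) ?_
  rw [injective_iff_map_eq_zero]
  intro x hx
  obtain ⟨x, rfl⟩ := Ideal.Quotient.mk_surjective x
  rw [Ideal.quotient_map_mkₐ, Ideal.Quotient.mkₐ_eq_mk, Ideal.Quotient.eq_zero_iff_mem] at hx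
  exact Ideal.Quotient.eq_zero_iff_mem.2 hx

theorem of_algEquiv (h : HasDimensionBound k A n) (E : A ≃ₐ[k] B) : HasDimensionBound k B n := by
  intro p hp
  obtain ⟨e, he, hn⟩ := h (p.comap E) inferInstance
  refine ⟨e, he.trans (trdeg_quotient_comap_le (E : A →ₐ[k] B) p), ?_⟩
  · rwa [← E.toRingEquiv.height_comap p]

theorem zero : HasDimensionBound k A 0 := fun _ _ => ⟨0, by simp, by simp⟩

/-- Extension of primes to `A[X]` is strictly monotone, because contraction undoes it; so it carries
chains of primes to chains. -/
theorem height_le_height_map_C (q : Ideal A) [hq : q.IsPrime] :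
    q.height ≤ (q.map (Polynomial.C : A →+* Polynomial A)).height := by
  let φ : PrimeSpectrum A → PrimeSpectrum (Polynomial A) := fun q =>
    ⟨q.asIdeal.map Polynomial.C, @Ideal.isPrime_map_C_of_isPrime _ _ _ q.2⟩
  have hφ : StrictMono φ := by
    refine Monotone.strictMono_of_injective (fun a b hab => Ideal.map_mono hab) ?_
    intro a b hab
    have hc : ∀ q : PrimeSpectrum A, (q.asIdeal.map (Polynomial.C : A →+* _)).comap Polynomial.C
        = q.asIdeal := fun q => by
      ext x
      rw [Ideal.mem_comap, Ideal.mem_map_C_iff]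
      refine ⟨fun h => by simpa using h 0, fun h i => ?_⟩
      rw [Polynomial.coeff_C]
      split_ifs <;> simp [h]
    ext1
    rw [← hc a, ← hc b]
    exact congrArg (fun x : PrimeSpectrum (Polynomial A) => x.asIdeal.comap Polynomial.C) hab
  have := Order.height_le_height_apply_of_strictMono φ hφ ⟨q, hq⟩
  rwa [← PrimeSpectrum.height_eq_orderHeight, ← PrimeSpectrum.height_eq_orderHeight] at this

/-- Compare `P` with the extension of its contraction `q`. If they agree, the quotient is `(A ⧸
q)[X]` and the transcendence degree grows by one; otherwise the height does. -/
theorem polynomial (h : HasDimensionBound k A n) : HasDimensionBound k (Polynomial A) (n + 1) := by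
  intro P hP
  set q := P.comap (Polynomial.C : A →+* Polynomial A) with hq
  obtain ⟨e, he, hn⟩ := h q inferInstance
  have hle : q.map Polynomial.C ≤ P := Ideal.map_comap_le
  have hht := height_le_height_map_C q
  have hqm : (q.map (Polynomial.C : A →+* _)).IsPrime := Ideal.isPrime_map_C_of_isPrime
  rcases hle.eq_or_lt with heq | hlt
  · refine ⟨e + 1, ?_, ?_⟩
    · let g : Polynomial (A ⧸ q) ≃ₐ[k] (Polynomial A ⧸ q.map (Polynomial.C : A →+* _)) :=
        AlgEquiv.ofRingEquiv (f := Ideal.polynomialQuotientEquivQuotientPolynomial q) fun r => by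
          rw [Polynomial.algebraMap_apply, IsScalarTower.algebraMap_apply k A (A ⧸ q),
            Ideal.Quotient.algebraMap_eq, ← Polynomial.map_C,
            Ideal.polynomialQuotientEquivQuotientPolynomial_map_mk]
          rfl
      rw [← heq, ← g.trdeg_eq, ← trdeg_add_eq k (A ⧸ q) (A := Polynomial (A ⧸ q)),
        Polynomial.trdeg_of_isDomain]
      push_cast
      gcongr
    · rw [← heq]
      push_cast
      calc (n : ℕ∞) + 1 ≤ e + q.height + 1 := by gcongr
        _ = e + 1 + q.height := by ring
        _ ≤ _ := by gcongr
  · refine ⟨e, he.trans (trdeg_quotient_comap_le (Polynomial.CAlgHom : A →ₐ[k] _) P), ?_⟩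
    · push_cast
      calc (n : ℕ∞) + 1 ≤ e + q.height + 1 := by gcongr
        _ = e + (q.height + 1) := by ring
        _ ≤ e + ((q.map (Polynomial.C : A →+* _)).height + 1) := by gcongr
        _ ≤ _ := by
          gcongr
          exact Ideal.height_add_one_le_of_lt_of_isPrime hlt

theorem mvPolynomial (k : Type) [Field k] (σ : Type) [Finite σ] :
    HasDimensionBound k (MvPolynomial σ k) (Nat.card σ) := by
  induction σ using Finite.induction_empty_option with
  | of_equiv e H => rw [← Nat.card_congr e]; exact H.of_algEquiv (MvPolynomial.renameEquiv k e)
  | h_empty => simpa using zero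
  | h_option IH =>
    rw [Finite.card_option]
    exact IH.polynomial.of_algEquiv (MvPolynomial.optionEquivLeft k _).symm

end HasDimensionBound

/-! ### Elimination on the incidence variety of coefficients and torus points -/

section GenericRelation

open MvPolynomial in
-- Serves to specialise the coefficients first in a relation between coordinates and coefficients.
theorem MvPolynomial.aeval_map_eval_sumAlgEquiv {k L S M : Type} [Field k] [Field L]
    [Algebra k L] (x : S → L) (c : M → k) (G : MvPolynomial (S ⊕ M) k) :
    aeval x (map (eval c) (sumAlgEquiv k S M G)) =
      aeval (Sum.elim x fun m => algebraMap k L (c m)) G := by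
  induction G using MvPolynomial.induction_on with
  | C a => simp [sumAlgEquiv_C_inl]
  | add p q hp hq => simp only [map_add, hp, hq]
  | mul_X p i hp =>
    simp only [map_mul, hp]
    congr 1
    rcases i with i | i
    · simp [sumAlgEquiv_X_inl]
    · simp [sumAlgEquiv_X_inr]

variable {k M σ : Type} [Field k] [Fintype σ]

/-- Laurent polynomials in the variables `σ`, with polynomial parameters `M`. -/
abbrev LaurentRing (k M σ : Type) [Field k] [Fintype σ] : Type :=
  Localization.Away (∏ n : σ, (MvPolynomial.X (Sum.inr n) : MvPolynomial (M ⊕ σ) k))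

theorem prod_X_inr_ne_zero :
    (∏ n : σ, (MvPolynomial.X (Sum.inr n) : MvPolynomial (M ⊕ σ) k)) ≠ 0 :=
  Finset.prod_ne_zero_iff.2 fun _ _ => MvPolynomial.X_ne_zero _

instance : IsDomain (LaurentRing k M σ) :=
  IsLocalization.isDomain_localization
    (powers_le_nonZeroDivisors_of_noZeroDivisors prod_X_inr_ne_zero)

theorem trdeg_laurentRing [Fintype M] :
    Algebra.trdeg k (LaurentRing k M σ) = (Fintype.card M + Fintype.card σ : ℕ) := by
  have hinj : Function.Injective (algebraMap (MvPolynomial (M ⊕ σ) k) (LaurentRing k M σ)) :=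
    IsLocalization.injective _
      (powers_le_nonZeroDivisors_of_noZeroDivisors prod_X_inr_ne_zero)
  have : FaithfulSMul (MvPolynomial (M ⊕ σ) k) (LaurentRing k M σ) :=
    (faithfulSMul_iff_algebraMap_injective _ _).2 hinj
  have : Algebra.IsAlgebraic (MvPolynomial (M ⊕ σ) k) (LaurentRing k M σ) :=
    IsLocalization.isAlgebraic _ (Submonoid.powers
      (∏ n : σ, (MvPolynomial.X (Sum.inr n) : MvPolynomial (M ⊕ σ) k)))
  rw [← trdeg_add_eq k (MvPolynomial (M ⊕ σ) k), MvPolynomial.trdeg_of_isDomain,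
    trdeg_eq_zero (R := MvPolynomial (M ⊕ σ) k)]
  simp

namespace LaurentRing

/-- The variable of a Laurent polynomial ring. -/
noncomputable def z (n : σ) : LaurentRing k M σ :=
  algebraMap (MvPolynomial (M ⊕ σ) k) _ (MvPolynomial.X (Sum.inr n))

theorem isUnit_z (n : σ) : IsUnit (z n : LaurentRing k M σ) := by
  have h := IsLocalization.Away.algebraMap_isUnit (S := LaurentRing k M σ)
    (∏ n : σ, (MvPolynomial.X (Sum.inr n) : MvPolynomial (M ⊕ σ) k))
  rw [map_prod] at h
  exact isUnit_of_dvd_unit (Finset.dvd_prod_of_mem _ (Finset.mem_univ n)) h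

/-- Evaluation at a point of the torus over an extension field. -/
theorem exists_lift {L : Type} [Field L] [Algebra k L] (c : M → k) (x : σ → L)
    (hx : ∀ n, x n ≠ 0) :
    ∃ ψ : LaurentRing k M σ →ₐ[k] L, (∀ n, ψ (z n) = x n) ∧
      ∀ m, ψ (algebraMap (MvPolynomial (M ⊕ σ) k) _ (MvPolynomial.X (Sum.inl m))) =
        algebraMap k L (c m) := by
  let f : MvPolynomial (M ⊕ σ) k →ₐ[k] L :=
    MvPolynomial.aeval (Sum.elim (fun m => algebraMap k L (c m)) x)
  have hf : ∀ y : Submonoid.powers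
      (∏ n : σ, (MvPolynomial.X (Sum.inr n) : MvPolynomial (M ⊕ σ) k)), IsUnit (f y) := by
    rintro ⟨_, j, rfl⟩
    simp only [f, map_pow, map_prod, MvPolynomial.aeval_X, Sum.elim_inr]
    exact (IsUnit.mk0 _ (Finset.prod_ne_zero_iff.2 fun n _ => hx n)).pow _
  refine ⟨IsLocalization.liftAlgHom (f := f) hf, fun n => ?_, fun m => ?_⟩
  · simp [z, f]
  · simp [f]

end LaurentRing

/-- For generic coefficients, the solutions in a torus of `l` equations with disjoint nonempty
sets of coefficients satisfy a nontrivial relation in any more than `|σ| - l` coordinates. -/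
theorem exists_generic_relation [Fintype M] {l : ℕ} (A : Fin l → Finset M)
    (hA : ∀ i j m, m ∈ A i → m ∈ A j → i = j) (hne : ∀ i, (A i).Nonempty)
    (a : M → σ → ℕ) (T : Finset σ) (hT : Fintype.card σ < T.card + l) :
    ∃ Q : MvPolynomial M k, Q ≠ 0 ∧ ∀ c : M → k, MvPolynomial.eval c Q ≠ 0 →
      ∀ (L : Type) [Field L] [Algebra k L] (x : σ → L), (∀ n, x n ≠ 0) →
        (∀ i, ∑ m ∈ A i, algebraMap k L (c m) * ∏ n, x n ^ a m n = 0) →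
          ¬ AlgebraicIndependent k (fun t : T => x t) := by
  classical
  -- The coefficient at `m₀ i` is the one that equation `i` is solved for. The others, `M'`, remain
  -- free parameters.
  choose m₀ hm₀ using hne
  have hinj : Function.Injective m₀ := fun i j h => hA i j _ (hm₀ i) (h ▸ hm₀ j)
  let M' := {m : M // m ∉ Set.range m₀}
  let D := LaurentRing k M' σ
  -- The default `0` is never used: by disjointness, `m₀ i` is the only chosen index in `A i`.
  let y' : M → D := fun m => if h : m ∉ Set.range m₀ then
    algebraMap (MvPolynomial (M' ⊕ σ) k) D (MvPolynomial.X (Sum.inl ⟨m, h⟩)) else 0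
  let Z : M → D := fun m => ∏ n, LaurentRing.z n ^ a m n
  -- Together with the `z n`, this is the universal solution. `Ring.inverse` is a true inverse here,
  -- since `Z m` is a product of units.
  let y : M → D := fun m => if h : ∃ i, m₀ i = m then
    -(∑ m' ∈ (A h.choose).erase m, y' m' * Z m') * Ring.inverse (Z m) else y' m
  have hcard : Fintype.card M' + l = Fintype.card M := by
    have h1 : Fintype.card M' = Fintype.card M - Fintype.card (Set.range m₀) :=
      Fintype.card_compl_set _
    have h2 : Fintype.card (Set.range m₀) = l := by
      rw [Set.card_range_of_injective hinj, Fintype.card_fin]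
    have h3 := Fintype.card_le_of_injective m₀ hinj
    rw [Fintype.card_fin] at h3
    omega
  -- There are `|T| + |M'| + l` elements in a ring of transcendence degree `|M'| + |σ|`.
  have hdep : ¬ AlgebraicIndependent k (Sum.elim (fun t : T => (LaurentRing.z t.1 : D)) y) := by
    intro h
    have h1 := h.cardinalMk_le_trdeg
    rw [trdeg_laurentRing, Cardinal.mk_fintype, Nat.cast_le, Fintype.card_sum,
      Fintype.card_coe] at h1
    omega
  rw [algebraicIndependent_iff] at hdep
  push Not at hdep
  obtain ⟨G, hG0, hG⟩ := hdep
  have hG' : MvPolynomial.sumAlgEquiv k T M G ≠ 0 := by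
    simpa using hG
  -- `Q` is a nonzero coefficient of `G` as a polynomial in the coordinates `T`; where it does not
  -- vanish, the specialised relation is nontrivial.
  obtain ⟨e, he⟩ := MvPolynomial.ne_zero_iff.1 hG'
  refine ⟨_, he, ?_⟩
  intro c hc L _ _ x hx hsol hind
  obtain ⟨ψ, hψz, hψX⟩ := LaurentRing.exists_lift (M := M') (fun m => c m) x hx
  have hψy' : ∀ m, m ∉ Set.range m₀ → ψ (y' m) = algebraMap k L (c m) := by
    intro m hm
    simp only [y', dif_pos hm]
    exact hψX _
  have hψZ : ∀ m, ψ (Z m) = ∏ n, x n ^ a m n := by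
    intro m
    simp only [Z, map_prod, map_pow, hψz]
  -- The universal solution specialises to `(c, x)`: equation `i` determines `c (m₀ i)`, as its
  -- monomial does not vanish at `x`.
  have hψy : ∀ m, ψ (y m) = algebraMap k L (c m) := by
    intro m
    by_cases h : ∃ i, m₀ i = m
    · have hi := h.choose_spec
      set i := h.choose with hidef
      have hZu : IsUnit (Z m) := IsUnit.prod_univ_iff.2 fun n => (LaurentRing.isUnit_z n).pow _
      have hmul : y m * Z m = -∑ m' ∈ (A i).erase m, y' m' * Z m' := by
        simp only [y, dif_pos h]
        rw [mul_assoc, Ring.inverse_mul_cancel _ hZu, mul_one]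
      have hs := hsol i
      have hmi : m ∈ A i := hi ▸ hm₀ i
      rw [← Finset.add_sum_erase _ _ hmi] at hs
      have h2 := congrArg ψ hmul
      rw [map_mul, map_neg, map_sum, hψZ] at h2
      have h3 : ∑ m' ∈ (A i).erase m, ψ (y' m' * Z m') =
          ∑ m' ∈ (A i).erase m, algebraMap k L (c m') * ∏ n, x n ^ a m' n := by
        refine Finset.sum_congr rfl fun m' hm' => ?_
        rw [Finset.mem_erase] at hm'
        rw [map_mul, hψZ, hψy']
        rintro ⟨j, rfl⟩
        have := hA i j _ hm'.2 (hm₀ j)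
        exact hm'.1 (by rw [← hi, this])
      rw [h3] at h2
      have hne : ∏ n, x n ^ a m n ≠ 0 :=
        Finset.prod_ne_zero_iff.2 fun n _ => pow_ne_zero _ (hx n)
      refine mul_right_cancel₀ hne ?_
      linear_combination h2 - hs
    · simp only [y, dif_neg h]
      exact hψy' m (by rintro ⟨i, hi⟩; exact h ⟨i, hi⟩)
  have hev : MvPolynomial.aeval (Sum.elim (fun t : T => x t) fun m => algebraMap k L (c m)) G
      = 0 := by
    have h1 := congrArg ψ hG0
    have hcomp : ∀ v : (T ⊕ M) → D, ψ (MvPolynomial.aeval v G) =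
        MvPolynomial.aeval (fun j => ψ (v j)) G := fun v =>
      DFunLike.congr_fun (MvPolynomial.comp_aeval v ψ) G
    rw [map_zero, hcomp] at h1
    rw [← h1]
    congr 2
    funext j
    rcases j with j | j
    · simp [hψz]
    · simp [hψy]
  rw [← MvPolynomial.aeval_map_eval_sumAlgEquiv] at hev
  have h0 := (algebraicIndependent_iff.1 hind) _ hev
  apply hc
  have h2 := congrArg (MvPolynomial.coeff e) h0
  rwa [MvPolynomial.coeff_map, MvPolynomial.coeff_zero] at h2

end GenericRelation

/-! ### Codimension in an open subset of a spectrum -/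

section Topology

open TopologicalSpace

variable {R : Type*} [CommRing R] {U : Set (PrimeSpectrum R)}

/-- A lower set contains everything below each of its points. Open sets are lower sets of primes, so
heights in `U` are heights in the spectrum. -/
theorem height_subtype_of_isLowerSet {α : Type*} [PartialOrder α] {s : Set α} (hs : IsLowerSet s)
    (x : s) : Order.height x = Order.height (x : α) := by
  have e : Set.Iic x ≃o Set.Iic (x : α) :=
    { toFun := fun y => ⟨y.1.1, y.2⟩
      invFun := fun y => ⟨⟨y.1, hs y.2 x.2⟩, y.2⟩
      left_inv := fun _ => rfl
      right_inv := fun _ => rfl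
      map_rel_iff' := Iff.rfl }
  have := Order.krullDim_eq_of_orderIso e
  rw [← Order.height_eq_krullDim_Iic, ← Order.height_eq_krullDim_Iic] at this
  exact_mod_cast this

/-- Irreducible closed subsets of an open subset `U` of the spectrum correspond to the points
of `U`, and their codimension is the height of the corresponding prime. -/
theorem exists_equiv_irreducibleCloseds (hU : IsOpen U) :
    ∃ Φ : IrreducibleCloseds U ≃ U,
      (∀ (Z : IrreducibleCloseds U) p, p ∈ (Z : Set U) ↔ (Φ Z).1 ≤ p.1) ∧
      ∀ Z, Order.coheight Z = (Φ Z).1.asIdeal.height := by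
  have : QuasiSober U := hU.isOpenEmbedding_subtypeVal.quasiSober
  have hlow : IsLowerSet U := fun x y hyx hx =>
    ((PrimeSpectrum.le_iff_specializes y x).1 hyx).mem_open hU hx
  let Φ : IrreducibleCloseds U ≃ U := irreducibleSetEquivPoints.toEquiv
  have hmem : ∀ (Z : IrreducibleCloseds U) p, p ∈ (Z : Set U) ↔ (Φ Z).1 ≤ p.1 := by
    intro Z p
    have h1 : (Z : Set U) = closure {Φ Z} := by
      conv_lhs => rw [← Φ.symm_apply_apply Z]
      rfl
    rw [h1, ← specializes_iff_mem_closure, PrimeSpectrum.le_iff_specializes]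
    exact (Topology.IsInducing.subtypeVal.specializes_iff).symm
  let Ψ : IrreducibleCloseds U ≃o (U)ᵒᵈ :=
    { toEquiv := Φ.trans OrderDual.toDual
      map_rel_iff' := by
        intro a b
        change (Φ b).1 ≤ (Φ a).1 ↔ a ≤ b
        refine ⟨fun h q hq => ?_, fun h => (hmem b _).1 (h ((hmem a _).2 le_rfl))⟩
        exact (hmem b q).2 (h.trans ((hmem a q).1 hq)) }
  refine ⟨Φ, hmem, fun Z => ?_⟩
  rw [PrimeSpectrum.height_eq_orderHeight, ← height_subtype_of_isLowerSet hlow,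
    ← Order.coheight_orderIso Ψ Z]
  rfl

/-- A section is regular as soon as its zero locus contains no prime of height less than the
number of equations. -/
theorem CliffordMirror.isRegularSection_of_le_height [IsNoetherianRing R] (hU : IsOpen U)
    {l : ℕ} (f : Fin l → R)
    (h : ∀ p ∈ U, (∀ i, f i ∈ p.asIdeal) → (l : ℕ∞) ≤ p.asIdeal.height) :
    CliffordMirror.IsRegularSection U f := by
  obtain ⟨Φ, hmem, hco⟩ := exists_equiv_irreducibleCloseds hU
  have hlow : IsLowerSet U := fun x y hyx hx =>
    ((PrimeSpectrum.le_iff_specializes y x).1 hyx).mem_open hU hx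
  refine ⟨?_, fun Z hZ => ?_⟩
  · have h1 : CliffordMirror.zeroLocusIn U f =
        Subtype.val ⁻¹' PrimeSpectrum.zeroLocus (Set.range f) := by
      ext p
      simp [CliffordMirror.zeroLocusIn, PrimeSpectrum.mem_zeroLocus, Set.range_subset_iff]
    rw [h1]
    exact (PrimeSpectrum.isClosed_zeroLocus _).preimage continuous_subtype_val
  · have hp : ∀ i, f i ∈ (Φ Z).1.asIdeal := hZ.1 ((hmem Z _).2 le_rfl)
    have hle : Ideal.span (Set.range f) ≤ (Φ Z).1.asIdeal := by
      rw [Ideal.span_le]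
      rintro _ ⟨i, rfl⟩
      exact hp i
    -- A smaller prime over the equations is again in `U`, so it would give a larger irreducible
    -- closed subset of the zero locus.
    have hmin : (Φ Z).1.asIdeal ∈ (Ideal.span (Set.range f)).minimalPrimes := by
      refine ⟨⟨(Φ Z).1.2, hle⟩, ?_⟩
      rintro q ⟨hq, hfq⟩ hqp
      have hqU : (⟨q, hq⟩ : PrimeSpectrum R) ∈ U :=
        hlow (b := ⟨q, hq⟩) (a := (Φ Z).1) hqp (Φ Z).2
      let W := Φ.symm ⟨⟨q, hq⟩, hqU⟩
      have hΦW : Φ W = ⟨⟨q, hq⟩, hqU⟩ := Φ.apply_symm_apply _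
      have hW : (W : Set U) ⊆ CliffordMirror.zeroLocusIn U f := by
        intro x hx i
        rw [hmem, hΦW] at hx
        exact hx (hfq (Ideal.subset_span ⟨i, rfl⟩))
      have hZW : Z ≤ W := by
        intro x hx
        change x ∈ (Z : Set U) at hx
        change x ∈ (W : Set U)
        rw [hmem] at hx ⊢
        rw [hΦW]
        exact le_trans (show (⟨q, hq⟩ : PrimeSpectrum R) ≤ _ from hqp) hx
      have h2 : Φ W ∈ (Z : Set U) := hZ.2 hW hZW ((hmem W _).2 le_rfl)
      rw [hmem, hΦW] at h2
      exact h2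
    rw [hco]
    refine le_antisymm ?_ (h _ (Φ Z).2 hp)
    refine (Ideal.height_le_card_of_mem_minimalPrimes_span (Set.finite_range f) hmin).trans ?_
    rw [← Set.image_univ]
    exact_mod_cast (Set.ncard_image_le Set.finite_univ).trans (by simp)

end Topology

/-! ### Convex geometry of cones and their duals -/

namespace CliffordMirror

section Cones

open Filter Topology

variable {d : ℕ}

theorem mem_dualCone {K : PointedCone ℝ (Fin d → ℝ)} {y : Fin d → ℝ} :
    y ∈ dualCone K ↔ ∀ x ∈ K, 0 ≤ x ⬝ᵥ y := by
  simp [dualCone, PointedCone.mem_dual]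

theorem mem_coneOf {σ : Finset (Fin d → ℤ)} {y : Fin d → ℝ} :
    y ∈ coneOf σ ↔ ∃ a : (Fin d → ℤ) → ℝ, (∀ n, 0 ≤ a n) ∧ y = ∑ n ∈ σ, a n • toReal n := by
  constructor
  · intro hy
    induction hy using Submodule.span_induction with
    | mem x hx =>
      classical
      obtain ⟨n, hn, rfl⟩ := hx
      refine ⟨Pi.single n 1, fun m => ?_, ?_⟩
      · exact (Pi.single_nonneg.2 zero_le_one : (0 : (Fin d → ℤ) → ℝ) ≤ Pi.single n 1) m
      · rw [Finset.sum_eq_single_of_mem n hn]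
        · simp
        · intro m _ hm
          simp [Pi.single_eq_of_ne hm]
    | zero => exact ⟨0, fun _ => le_rfl, by simp⟩
    | add x y _ _ hx hy =>
      obtain ⟨a, ha, rfl⟩ := hx
      obtain ⟨b, hb, rfl⟩ := hy
      exact ⟨a + b, fun n => add_nonneg (ha n) (hb n), by
        simp [add_smul, Finset.sum_add_distrib]⟩
    | smul c x _ hx =>
      obtain ⟨a, ha, rfl⟩ := hx
      refine ⟨fun n => c * a n, fun n => mul_nonneg c.2 (ha n), ?_⟩
      change (c : ℝ) • (∑ n ∈ σ, a n • toReal n) = _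
      simp [Finset.smul_sum, smul_smul]
  · rintro ⟨a, ha, rfl⟩
    refine Submodule.sum_mem _ fun n hn => ?_
    exact (coneOf σ).smul_mem (ha n) (Submodule.subset_span ⟨n, hn, rfl⟩)

/-- A cone that spans the space contains a vector outside the kernels of finitely many nonzero
linear functions. -/
theorem exists_mem_forall_apply_ne_zero {K : PointedCone ℝ (Fin d → ℝ)}
    (hK : Submodule.span ℝ (K : Set (Fin d → ℝ)) = ⊤)
    {ι : Type*} (s : Finset ι) (φ : ι → (Fin d → ℝ) →ₗ[ℝ] ℝ) (hφ : ∀ i ∈ s, φ i ≠ 0) :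
    ∃ w ∈ K, ∀ i ∈ s, φ i w ≠ 0 := by
  classical
  induction s using Finset.induction_on with
  | empty => exact ⟨0, K.zero_mem, by simp⟩
  | insert i s hi ih =>
    obtain ⟨w, hw, hws⟩ := ih fun j hj => hφ j (Finset.mem_insert_of_mem hj)
    obtain ⟨v, hv, hvi⟩ : ∃ v ∈ K, φ i v ≠ 0 := by
      by_contra! h
      apply hφ i (Finset.mem_insert_self _ _)
      exact LinearMap.ext_on hK fun x hx => h x hx
    -- Along the ray `w + n v` each of these functions is affine in `n` and not identically zero, so
    -- it vanishes for at most one `n`.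
    have hev : ∀ j ∈ insert i s, ∀ᶠ n : ℕ in atTop, φ j (w + (n : ℝ) • v) ≠ 0 := by
      intro j hj
      have hne : φ j w ≠ 0 ∨ φ j v ≠ 0 := by
        rcases Finset.mem_insert.1 hj with rfl | hj
        · exact Or.inr hvi
        · exact Or.inl (hws j hj)
      have hsub : {n : ℕ | φ j (w + (n : ℝ) • v) = 0}.Subsingleton := by
        intro n hn m hm
        simp only [Set.mem_ofPred_eq, map_add, map_smul, smul_eq_mul] at hn hm
        by_contra hnm
        have hnm' : (n : ℝ) - m ≠ 0 := sub_ne_zero.2 (by exact_mod_cast hnm)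
        have h1 : φ j v = 0 := by
          have : ((n : ℝ) - m) * φ j v = 0 := by linear_combination hn - hm
          exact (mul_eq_zero.1 this).resolve_left hnm'
        rw [h1] at hn
        rcases hne with h | h
        · exact h (by linarith)
        · exact h h1
      rw [← Nat.cofinite_eq_atTop]
      exact hsub.finite.compl_mem_cofinite
    obtain ⟨n, hn⟩ := ((Finset.eventually_all _).2 hev).exists
    exact ⟨_, K.add_mem hw (K.smul_mem n.cast_nonneg hv), hn⟩

end Cones

/-! ### Maximal cones of a simplicial fan -/

namespace SimplicialFan

open Filter Topology

variable {d : ℕ} {A : Set (Fin d → ℤ)} (F : SimplicialFan A)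

theorem finite_cells (hA : A.Finite) : F.cells.Finite := by
  refine (hA.toFinset.powerset.finite_toSet).subset fun σ hσ => ?_
  simp only [Finset.coe_powerset, Set.mem_preimage, Set.mem_powerset_iff]
  intro n hn
  simpa using F.subset_rays σ hσ n hn

variable {F}

theorem card_le {σ : Finset (Fin d → ℤ)} (hσ : σ ∈ F.cells) : σ.card ≤ d := by
  have := (F.simplicial σ hσ).fintype_card_le_finrank
  simpa using this

/-- The linear functions that read off the coordinates with respect to a cone of maximal
dimension. -/
theorem exists_coord {σ : Finset (Fin d → ℤ)} (hσ : σ ∈ F.cells) (hd : σ.card = d) :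
    ∃ φ : (Fin d → ℤ) → (Fin d → ℝ) →ₗ[ℝ] ℝ,
      (∀ a : (Fin d → ℤ) → ℝ, ∀ n ∈ σ, φ n (∑ m ∈ σ, a m • toReal m) = a n) ∧
      ∀ x, x = ∑ n ∈ σ, φ n x • toReal n := by
  classical
  let b := Module.Basis.mk (F.simplicial σ hσ)
    ((F.simplicial σ hσ).span_eq_top_of_card_eq_finrank' (by simpa using hd)).ge
  have hb : ∀ n : σ, b n = toReal (n : Fin d → ℤ) := fun n => by simp [b]
  have hsum : ∀ a : (Fin d → ℤ) → ℝ, ∑ m ∈ σ, a m • toReal m = ∑ m : σ, a m • b m := by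
    intro a
    rw [← Finset.sum_coe_sort]
    simp only [hb]
  let φ : (Fin d → ℤ) → (Fin d → ℝ) →ₗ[ℝ] ℝ := fun n => if h : n ∈ σ then b.coord ⟨n, h⟩ else 0
  refine ⟨φ, fun a n hn => ?_, fun x => ?_⟩
  · simp only [φ, dif_pos hn, Module.Basis.coord_apply]
    rw [hsum, b.repr_sum_self]
  · rw [hsum fun n => φ n x]
    conv_lhs => rw [← b.sum_repr x]
    refine Finset.sum_congr rfl fun n _ => ?_
    simp [φ]

/-- If the support of a fan is a full-dimensional convex cone, then each of its points lies in a
cone of maximal dimension. -/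
theorem exists_mem_coneOf_card_eq {C : PointedCone ℝ (Fin d → ℝ)}
    (hA : A.Finite) (hC : Submodule.span ℝ (C : Set (Fin d → ℝ)) = ⊤) (hF : F.support = C)
    {x : Fin d → ℝ} (hx : x ∈ C) : ∃ σ ∈ F.cells, σ.card = d ∧ x ∈ coneOf σ := by
  classical
  have hfin := F.finite_cells hA
  -- A cone of smaller dimension lies in a hyperplane, with equation `φ`.
  have hφ : ∀ σ : Finset (Fin d → ℤ), ∃ φ : (Fin d → ℝ) →ₗ[ℝ] ℝ,
      σ.card < d → φ ≠ 0 ∧ ∀ y ∈ coneOf σ, φ y = 0 := by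
    intro σ
    by_cases hσ : σ.card < d
    · have hlt : Submodule.span ℝ (toReal '' (σ : Set (Fin d → ℤ))) < ⊤ := by
        refine lt_top_iff_ne_top.2 fun h => ?_
        have h1 : Module.finrank ℝ (Submodule.span ℝ ((σ.image toReal : Finset _) :
            Set (Fin d → ℝ))) = d := by
          rw [Finset.coe_image, h]; simp
        have h2 := finrank_span_finset_le_card (R := ℝ) (σ.image toReal)
        rw [Set.finrank, h1] at h2
        exact absurd (h2.trans Finset.card_image_le) (by omega)
      obtain ⟨φ, hφ, hle⟩ := Submodule.exists_le_ker_of_lt_top _ hlt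
      refine ⟨φ, fun _ => ⟨hφ, fun y hy => ?_⟩⟩
      obtain ⟨a, -, rfl⟩ := mem_coneOf.1 hy
      rw [map_sum]
      refine Finset.sum_eq_zero fun n hn => ?_
      rw [map_smul, LinearMap.mem_ker.1 (hle (Submodule.subset_span ⟨n, hn, rfl⟩)), smul_zero]
    · exact ⟨0, fun h => absurd h hσ⟩
  choose φ hφ using hφ
  obtain ⟨w, hw, hwφ⟩ := exists_mem_forall_apply_ne_zero hC
    (hfin.toFinset.filter fun σ => σ.card < d) φ fun σ hσ => (hφ σ (Finset.mem_filter.1 hσ).2).1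
  by_contra! hcon
  -- These points of `C` tend to `x` in a direction transverse to all the hyperplanes. Each smaller
  -- cone contains at most one of them, and a maximal cone, being closed, contains only finitely
  -- many unless it contains `x`. So some `y n` would lie outside the support.
  let y : ℕ → Fin d → ℝ := fun n => x + (1 / ((n : ℝ) + 1)) • w
  have hy : Tendsto y atTop (𝓝 x) := by
    have h1 := (tendsto_one_div_add_atTop_nhds_zero_nat (𝕜 := ℝ)).smul_const w
    simpa [y] using h1.const_add x
  have hev : ∀ σ ∈ F.cells, ∀ᶠ n in atTop, y n ∉ coneOf σ := by
    intro σ hσ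
    rcases (card_le hσ).lt_or_eq with hlt | heq
    · have hw0 : φ σ w ≠ 0 := hwφ σ (by simp [hσ, hlt])
      have hsub : {n : ℕ | y n ∈ coneOf σ}.Subsingleton := by
        intro n hn m hm
        have h1 := (hφ σ hlt).2 _ hn
        have h2 := (hφ σ hlt).2 _ hm
        simp only [y, map_add, map_smul, smul_eq_mul] at h1 h2
        have h3 : 1 / ((n : ℝ) + 1) = 1 / ((m : ℝ) + 1) :=
          mul_right_cancel₀ hw0 (by linear_combination h1 - h2)
        have h4 : (n : ℝ) + 1 = m + 1 := by simpa using h3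
        exact_mod_cast add_right_cancel h4
      rw [← Nat.cofinite_eq_atTop]
      exact hsub.finite.compl_mem_cofinite
    · by_contra hnot
      have hfreq : ∃ᶠ n in atTop, y n ∈ coneOf σ := by
        simpa [Filter.Frequently] using hnot
      obtain ⟨ψ, hψ, hψx⟩ := exists_coord hσ heq
      apply hcon σ hσ heq
      rw [mem_coneOf]
      have hnn : ∀ n ∈ σ, 0 ≤ ψ n x := by
        intro n hn
        have hlim : Tendsto (fun j => ψ n (y j)) atTop (𝓝 (ψ n x)) :=
          ((ψ n).continuous_of_finiteDimensional.tendsto x).comp hy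
        refine ge_of_tendsto_of_frequently hlim (hfreq.mono fun j hj => ?_)
        obtain ⟨a, ha, hya⟩ := mem_coneOf.1 hj
        rw [hya, hψ a n hn]
        exact ha n
      -- The maximum only serves indices outside `σ`, where nothing is known about the sign of `ψ n
      -- x`.
      refine ⟨fun n => max (ψ n x) 0, fun n => le_max_right _ _, ?_⟩
      conv_lhs => rw [hψx x]
      exact Finset.sum_congr rfl fun n hn => by simp only [max_eq_left (hnn n hn)]
  obtain ⟨n, hn⟩ := ((eventually_all_finite hfin).2 hev).exists
  have hyC : y n ∈ F.support := by
    rw [hF]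
    exact C.add_mem hx (C.smul_mem (by positivity) hw)
  simp only [support, Set.mem_iUnion] at hyC
  obtain ⟨σ, hσ, hyσ⟩ := hyC
  exact hn σ hσ hyσ

/-- If `t` is a ray generator of all cones of maximal dimension, then from the sum of the generators
of a cone without the ray of `t` no positive multiple of `t` can be subtracted inside the support. -/
theorem sub_smul_notMem {C : PointedCone ℝ (Fin d → ℝ)}
    (hA : A.Finite) (hC : Submodule.span ℝ (C : Set (Fin d → ℝ)) = ⊤) (hF : F.support = C)
    {t : Fin d → ℤ} (ht : ∀ σ ∈ F.cells, σ.card = d → t ∈ σ) {I : Finset (Fin d → ℤ)}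
    (hI : I ∈ F.cells) (htI : t ∉ I) {ε : ℝ} (hε : 0 < ε) :
    ∑ n ∈ I, toReal n - ε • toReal t ∉ C := by
  classical
  intro hmem
  obtain ⟨σ, hσ, hd, hx⟩ := exists_mem_coneOf_card_eq hA hC hF hmem
  obtain ⟨φ, hφ, -⟩ := exists_coord hσ hd
  have htσ := ht σ hσ hd
  have hφt : φ t (toReal t) = 1 := by
    have h1 := hφ (Pi.single t 1) t htσ
    rw [Finset.sum_eq_single_of_mem t htσ fun m _ hm => by simp [Pi.single_eq_of_ne hm]] at h1
    simpa using h1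
  have hpσ : ∑ n ∈ I, toReal n ∈ coneOf σ := by
    have h1 : ∑ n ∈ I, toReal n = (∑ n ∈ I, toReal n - ε • toReal t) + ε • toReal t := by
      rw [sub_add_cancel]
    rw [h1]
    exact (coneOf σ).add_mem hx
      ((coneOf σ).smul_mem hε.le (Submodule.subset_span ⟨t, htσ, rfl⟩))
  have hpI : ∑ n ∈ I, toReal n ∈ coneOf I :=
    mem_coneOf.2 ⟨fun _ => 1, fun _ => zero_le_one, by simp⟩
  have hp : ∑ n ∈ I, toReal n ∈ (coneOf (I ∩ σ) : Set (Fin d → ℝ)) := by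
    rw [← F.inter_eq I hI σ hσ]
    exact ⟨hpI, hpσ⟩
  obtain ⟨a, -, ha⟩ := mem_coneOf.1 hp
  obtain ⟨b, hb, hxb⟩ := mem_coneOf.1 hx
  -- The sum lies in the face `I ∩ σ`, which omits `t`. Subtracting `ε • t` makes the `t`-coordinate
  -- `-ε`, which is impossible in the cone of `σ`.
  have h0 : φ t (∑ n ∈ I, toReal n) = 0 := by
    have h1 : ∑ n ∈ I ∩ σ, a n • toReal n =
        ∑ n ∈ σ, (if n ∈ I then a n else 0) • toReal n := by
      rw [Finset.inter_comm, ← Finset.filter_mem_eq_inter, Finset.sum_filter]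
      exact Finset.sum_congr rfl fun n _ => by split_ifs <;> simp
    rw [ha, h1, hφ (fun n => if n ∈ I then a n else 0) t htσ, if_neg htI]
  have h2 := congrArg (φ t) hxb
  rw [hφ b t htσ, map_sub, map_smul, h0, hφt, smul_eq_mul] at h2
  linarith [hb t]

end SimplicialFan

/-! ### The monomials of the equations -/

namespace CliffordDatum

open Filter Topology

variable {d : ℕ} {P : ReflexivePair d} {k r : ℕ} (D : CliffordDatum P k r)

theorem dotProduct_nonneg {m n : Fin d → ℤ} (hm : toReal m ∈ P.K)
    (hn : toReal n ∈ dualCone P.K) : 0 ≤ m ⬝ᵥ n := by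
  have := mem_dualCone.1 hn _ hm
  rw [toReal_dotProduct] at this
  exact_mod_cast this

/-- Pairing `m` with `deg^∨` gives `1`, and the `s_i` contribute a nonnegative amount. -/
theorem sum_dotProduct_t_le_one (m : P.K1) : ∑ i, m.1 ⬝ᵥ D.t i ≤ 1 := by
  have h1 : toReal m.1 ⬝ᵥ toReal P.degv = 1 := by
    rw [toReal_dotProduct, m.2.2, Int.cast_one]
  rw [D.decomposition, dotProduct_add, dotProduct_smul, dotProduct_sum, dotProduct_sum] at h1
  have h2 : 0 ≤ ∑ i, toReal m.1 ⬝ᵥ toReal (D.s i) :=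
    Finset.sum_nonneg fun i _ => mem_dualCone.1 (D.s_mem i) _ m.2.1
  have h3 : ∑ i, toReal m.1 ⬝ᵥ toReal (D.t i) ≤ 1 := by
    rw [smul_eq_mul] at h1
    linarith
  simp only [toReal_dotProduct] at h3
  exact_mod_cast h3

theorem dotProduct_t_le_one (m : P.K1) (i : Fin (k - r)) : m.1 ⬝ᵥ D.t i ≤ 1 :=
  (Finset.single_le_sum (f := fun i => m.1 ⬝ᵥ D.t i)
    (fun j _ => dotProduct_nonneg m.2.1 (D.t_mem j)) (Finset.mem_univ i)).trans
    (D.sum_dotProduct_t_le_one m)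

theorem eq_of_dotProduct_t_eq_one (m : P.K1) {i j : Fin (k - r)} (hi : m.1 ⬝ᵥ D.t i = 1)
    (hj : m.1 ⬝ᵥ D.t j = 1) : i = j := by
  classical
  by_contra hij
  have h1 := Finset.sum_le_univ_sum_of_nonneg (s := {i, j}) (f := fun i => m.1 ⬝ᵥ D.t i)
    fun j => dotProduct_nonneg m.2.1 (D.t_mem j)
  rw [Finset.sum_pair hij, hi, hj] at h1
  have := D.sum_dotProduct_t_le_one m
  omega

/-- None of the `f_i` vanishes identically on a torus orbit in the Cox open subset: for every
cone `I` of the fan without `t_i` there is a monomial of `f_i` that does not involve `I`. -/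
theorem exists_mem_K1 {I : Finset (Fin d → ℤ)} (hI : I ∈ D.fan.cells) (i : Fin (k - r))
    (hi : D.t i ∉ I) : ∃ m : P.K1, m.1 ⬝ᵥ D.t i = 1 ∧ ∀ n ∈ I, m.1 ⬝ᵥ n = 0 := by
  by_contra! hcon
  obtain ⟨S, hS, hext⟩ := P.gorenstein.rational.exists_extreme
  have hIC : ∀ n ∈ I, toReal n ∈ dualCone P.K := fun n hn => (D.fan.subset_rays I hI n hn).1
  set p := ∑ n ∈ I, toReal n with hp
  have hSK : ∀ v ∈ S, toReal v ∈ P.K := fun v hv => by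
    rw [hS]; exact Submodule.subset_span ⟨v, hv, rfl⟩
  -- The aim is `p - ε • t_i ∈ K^∨` for small `ε > 0`, against `sub_smul_notMem`. Only generators
  -- with `⟨v, p⟩ = 0` are critical. Their primitive generators lie in `K_(1)` and vanish on `I`, so
  -- under `hcon` they pair to `0` with `t_i`.
  have hev : ∀ v ∈ S, ∀ᶠ ε : ℝ in 𝓝[>] 0, ε * (toReal v ⬝ᵥ toReal (D.t i)) ≤ toReal v ⬝ᵥ p := by
    intro v hv
    have hvp : 0 ≤ toReal v ⬝ᵥ p := by
      rw [hp, dotProduct_sum]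
      exact Finset.sum_nonneg fun n hn => mem_dualCone.1 (hIC n hn) _ (hSK v hv)
    rcases hvp.eq_or_lt with h0 | hpos
    · obtain ⟨w, hw, a, ha, hva⟩ := exists_primitive (hSK v hv) (hext v hv).1 (hext v hv).2
      let m : P.K1 := ⟨w, hw.mem, P.gorenstein.degree w hw⟩
      have hwI : ∀ n ∈ I, w ⬝ᵥ n = 0 := by
        rw [hva, smul_dotProduct, smul_eq_mul, eq_comm, mul_eq_zero, or_iff_right ha.ne', hp,
          dotProduct_sum, Finset.sum_eq_zero_iff_of_nonneg
            (fun n hn => mem_dualCone.1 (hIC n hn) _ hw.mem)] at h0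
        intro n hn
        have := h0 n hn
        rw [toReal_dotProduct] at this
        exact_mod_cast this
      have hwt : w ⬝ᵥ D.t i = 0 := by
        have h1 : w ⬝ᵥ D.t i ≤ 1 := D.dotProduct_t_le_one m i
        have h2 := dotProduct_nonneg hw.mem (D.t_mem i)
        have h3 : w ⬝ᵥ D.t i ≠ 1 := fun h => by
          obtain ⟨n, hn, hne⟩ := hcon m h
          exact hne (hwI n hn)
        omega
      refine Eventually.of_forall fun ε => ?_
      rw [← h0, hva, smul_dotProduct, toReal_dotProduct, hwt]
      simp
    · have hlim : Tendsto (fun ε : ℝ => ε * (toReal v ⬝ᵥ toReal (D.t i))) (𝓝[>] 0) (𝓝 0) := by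
        have : Tendsto (fun ε : ℝ => ε * (toReal v ⬝ᵥ toReal (D.t i))) (𝓝 0)
            (𝓝 (0 * (toReal v ⬝ᵥ toReal (D.t i)))) := tendsto_id.mul_const _
        rw [zero_mul] at this
        exact this.mono_left nhdsWithin_le_nhds
      exact (hlim.eventually_lt_const hpos).mono fun _ h => h.le
  obtain ⟨ε, hε, hε0⟩ := (((Finset.eventually_all S).2 hev).and self_mem_nhdsWithin).exists
  refine SimplicialFan.sub_smul_notMem P.gorenstein_dual.finite_degreeOne
    P.gorenstein_dual.full_dim D.support_eq (fun σ hσ hd => (D.centrality σ hσ hd).2 i) hI hi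
    (Set.mem_Ioi.1 hε0) (mem_dualCone.2 fun x hx => ?_)
  rw [hS] at hx
  induction hx using Submodule.span_induction with
  | mem x hx =>
    obtain ⟨v, hv, rfl⟩ := hx
    rw [dotProduct_sub, dotProduct_smul, smul_eq_mul]
    exact sub_nonneg.2 (hε v hv)
  | zero => simp
  | add x y _ _ hx hy => rw [add_dotProduct]; exact add_nonneg hx hy
  | smul a x _ hx =>
    have h1 : (a • x) = (a : ℝ) • x := rfl
    rw [h1, smul_dotProduct]
    exact mul_nonneg a.2 hx

end CliffordDatum

end CliffordMirror


/-! ### Torus orbits of affine space -/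

section Strata

variable {k M σ : Type} [Field k] [Fintype M] [Fintype σ] {l : ℕ}

/-- The version of `exists_generic_relation` on the torus orbit on which exactly the coordinates
in `I` vanish. -/
theorem exists_generic_relation_of_orbit [DecidableEq σ] (A : Fin l → Finset M)
    (hA : ∀ i j m, m ∈ A i → m ∈ A j → i = j) (a : M → σ → ℕ) (I : Finset σ)
    (hne : ∀ i, ∃ m ∈ A i, ∀ n ∈ I, a m n = 0) (T : Finset {n // n ∉ I})
    (hT : Fintype.card {n // n ∉ I} < T.card + l) :
    ∃ Q : MvPolynomial M k, Q ≠ 0 ∧ ∀ c : M → k, MvPolynomial.eval c Q ≠ 0 →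
      ∀ (L : Type) [Field L] [Algebra k L] (x : σ → L), (∀ n, x n = 0 ↔ n ∈ I) →
        (∀ i, ∑ m ∈ A i, algebraMap k L (c m) * ∏ n, x n ^ a m n = 0) →
          ¬ AlgebraicIndependent k (fun t : T => x t.1) := by
  -- On the orbit exactly the monomials free of `I` survive; their factors at `I` are `0 ^ 0 = 1`.
  obtain ⟨Q, hQ0, hQ⟩ := exists_generic_relation (k := k)
    (fun i => (A i).filter fun m => ∀ n ∈ I, a m n = 0)
    (fun i j m hi hj => hA i j m (Finset.mem_filter.1 hi).1 (Finset.mem_filter.1 hj).1)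
    (fun i => (hne i).imp fun m hm => Finset.mem_filter.2 hm)
    (fun m (n : {n // n ∉ I}) => a m n) T hT
  refine ⟨Q, hQ0, fun c hc L _ _ x hx hsol => ?_⟩
  refine hQ c hc L (fun n => x n) (fun n => mt (hx n).1 n.2) fun i => ?_
  rw [← hsol i, Finset.sum_filter]
  refine Finset.sum_congr rfl fun m _ => ?_
  have hsplit := Fintype.prod_subtype_mul_prod_subtype (fun n => n ∉ I) fun n => x n ^ a m n
  split_ifs with h
  · rw [← hsplit, Finset.prod_eq_one (s := (Finset.univ : Finset {n // ¬ n ∉ I})), mul_one]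
    intro n _
    rw [h n (not_not.1 n.2), pow_zero]
  · push Not at h
    obtain ⟨n, hn, hne⟩ := h
    rw [Finset.prod_eq_zero (Finset.mem_univ n), mul_zero]
    rw [(hx n).2 hn, zero_pow hne]

/-- The residue ring of a prime of a polynomial ring has a transcendence basis that consists of
variables outside the prime. -/
theorem MvPolynomial.exists_transcendenceBasis_variables (p : Ideal (MvPolynomial σ k))
    [p.IsPrime] (I : Finset σ) (hI : ∀ n, n ∈ I → (X n : MvPolynomial σ k) ∈ p) :
    ∃ T : Finset {n // n ∉ I},
      AlgebraicIndependent k (fun t : T => Ideal.Quotient.mk p (X t.1.1)) ∧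
      (T.card : Cardinal) = Algebra.trdeg k (MvPolynomial σ k ⧸ p) := by
  classical
  let s : Set (MvPolynomial σ k ⧸ p) :=
    Set.range fun n : {n // n ∉ I} => Ideal.Quotient.mk p (X n.1)
  have htop : Algebra.adjoin k s = ⊤ := by
    rw [eq_top_iff]
    rintro y -
    obtain ⟨g, rfl⟩ := Ideal.Quotient.mk_surjective y
    induction g using MvPolynomial.induction_on with
    | C a => exact (Algebra.adjoin k s).algebraMap_mem a
    | add f g hf hg => rw [map_add]; exact add_mem hf hg
    | mul_X f n hf =>
      rw [map_mul]
      refine mul_mem hf ?_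
      by_cases hn : n ∈ I
      · rw [Ideal.Quotient.eq_zero_iff_mem.2 (hI n hn)]
        exact zero_mem _
      · exact Algebra.subset_adjoin ⟨⟨n, hn⟩, rfl⟩
  have halg : Algebra.IsAlgebraic (Algebra.adjoin k s) (MvPolynomial σ k ⧸ p) := by
    refine ⟨fun y => ?_⟩
    have hy : y ∈ Algebra.adjoin k s := htop ▸ Algebra.mem_top
    exact isAlgebraic_algebraMap (⟨y, hy⟩ : Algebra.adjoin k s)
  -- The classes of the variables outside `I` generate the residue ring, so a transcendence basis
  -- can be chosen among them.
  obtain ⟨t, hts, ht⟩ := isAlgebraic_iff_exists_isTranscendenceBasis_subset.1 halg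
  choose g hg using fun y : t => hts y.2
  have hinj : Function.Injective g := fun a b hab => Subtype.ext (by rw [← hg a, ← hg b, hab])
  have : Fintype t := Fintype.ofInjective g hinj
  let T : Finset {n // n ∉ I} := Finset.univ.image g
  let e : t ≃ T := Equiv.ofBijective (fun y => ⟨g y, Finset.mem_image_of_mem g (Finset.mem_univ y)⟩)
    ⟨fun a b hab => hinj (congrArg Subtype.val hab), fun n => by
      obtain ⟨y, -, hy⟩ := Finset.mem_image.1 n.2
      exact ⟨y, Subtype.ext hy⟩⟩
  refine ⟨T, ?_, ?_⟩
  · refine (algebraicIndependent_equiv' e ?_).1 ht.1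
    funext y
    exact hg y
  · rw [← ht.cardinalMk_eq_trdeg, Cardinal.mk_fintype, Finset.card_image_of_injective _ hinj,
      Finset.card_univ]

end Strata

/-! ### The Cox open subset and the final dimension count -/

namespace CliffordMirror

namespace CliffordDatum

variable {d : ℕ} {P : ReflexivePair d} {k r : ℕ} (D : CliffordDatum P k r)

/-- Near a point no further coordinate vanishes, and a fan contains the faces of its cones. -/
theorem isOpen_coxOpen : IsOpen D.coxOpen := by
  classical
  refine isOpen_iff_forall_mem_open.2 fun p hp => ?_
  obtain ⟨σ, hσ, hσp⟩ := hp
  let g : D.CoordRing := ∏ n : D.Coord with MvPolynomial.X n ∉ p.asIdeal, MvPolynomial.X n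
  refine ⟨PrimeSpectrum.basicOpen g, fun q hq => ?_, (PrimeSpectrum.basicOpen g).2, ?_⟩
  · have hsub : ∀ n : D.Coord, MvPolynomial.X n ∈ q.asIdeal → MvPolynomial.X n ∈ p.asIdeal := by
      intro n hn
      by_contra hnp
      refine hq (q.asIdeal.mem_of_dvd ?_ hn)
      exact Finset.dvd_prod_of_mem _ (by simpa using hnp)
    let S : Set (Fin d → ℤ) :=
      (Coord.val '' {n : D.Coord | (MvPolynomial.X n : D.CoordRing) ∈ q.asIdeal}) ∪
        (Set.range D.s ∪ Set.range D.t)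
    have hS : S ⊆ σ := by
      rw [hσp]
      exact Set.union_subset_union_left _ (Set.image_mono fun n hn => hsub n hn)
    refine ⟨σ.filter (· ∈ S), D.fan.face_mem σ hσ _ (Finset.filter_subset _ _), ?_⟩
    ext n
    simp only [Finset.coe_filter, Set.mem_ofPred_eq]
    exact ⟨fun h => h.2, fun h => ⟨hS h, h⟩⟩
  · change g ∉ p.asIdeal
    intro hg
    obtain ⟨n, hn, hnp⟩ := (Ideal.IsPrime.prod_mem_iff (hp := p.2)).1 hg
    exact (Finset.mem_filter.1 hn).2 hnp

end CliffordDatum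

end CliffordMirror

open CliffordMirror in
theorem proposition3p3 {d : ℕ} (P : CliffordMirror.ReflexivePair d) {k r : ℕ}
    (D : CliffordMirror.CliffordDatum P k r) :
    ∃ Q : MvPolynomial P.K1 ℂ, Q ≠ 0 ∧
      ∀ c : P.K1 → ℂ, MvPolynomial.eval c Q ≠ 0 →
        CliffordMirror.IsRegularSection D.coxOpen (D.f c) := by
  classical
  let A : Fin (k - r) → Finset P.K1 := fun i =>
    Finset.univ.filter fun m : P.K1 => m.1 ⬝ᵥ D.t i = 1
  have hA : ∀ i j m, m ∈ A i → m ∈ A j → i = j := fun i j m hi hj =>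
    D.eq_of_dotProduct_t_eq_one m (Finset.mem_filter.1 hi).2 (Finset.mem_filter.1 hj).2
  let a : P.K1 → D.Coord → ℕ := fun m n => (m.1 ⬝ᵥ n.val).toNat
  have hQ : ∀ (I : Finset D.Coord) (T : Finset {n // n ∉ I}), ∃ Q : MvPolynomial P.K1 ℂ, Q ≠ 0 ∧
      ((∀ i, ∃ m ∈ A i, ∀ n ∈ I, a m n = 0) →
        Fintype.card {n // n ∉ I} < T.card + (k - r) →
        ∀ c : P.K1 → ℂ, MvPolynomial.eval c Q ≠ 0 →
          ∀ (L : Type) [Field L] [Algebra ℂ L] (x : D.Coord → L), (∀ n, x n = 0 ↔ n ∈ I) →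
            (∀ i, ∑ m ∈ A i, algebraMap ℂ L (c m) * ∏ n, x n ^ a m n = 0) →
              ¬ AlgebraicIndependent ℂ (fun t : T => x t.1)) := by
    intro I T
    by_cases h : (∀ i, ∃ m ∈ A i, ∀ n ∈ I, a m n = 0) ∧
        Fintype.card {n // n ∉ I} < T.card + (k - r)
    · obtain ⟨Q, hQ0, hQ⟩ := exists_generic_relation_of_orbit (k := ℂ) A hA a I h.1 T h.2
      exact ⟨Q, hQ0, fun _ _ => hQ⟩
    · exact ⟨1, one_ne_zero, fun h1 h2 => absurd ⟨h1, h2⟩ h⟩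
  choose Q hQ0 hQ using hQ
  -- There are finitely many pairs `(I, T)`, so one polynomial serves all primes at once; pairs that
  -- impose no condition contribute `1`.
  refine ⟨∏ I, ∏ T, Q I T, Finset.prod_ne_zero_iff.2 fun I _ =>
    Finset.prod_ne_zero_iff.2 fun T _ => hQ0 I T, fun c hc => ?_⟩
  have hc' : ∀ I T, MvPolynomial.eval c (Q I T) ≠ 0 := by
    intro I T h
    apply hc
    rw [map_prod]
    refine Finset.prod_eq_zero (Finset.mem_univ I) ?_
    rw [map_prod]
    exact Finset.prod_eq_zero (Finset.mem_univ T) h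
  refine isRegularSection_of_le_height D.isOpen_coxOpen _ fun p hp hfp => ?_
  have hprime := p.2
  let I : Finset D.Coord := Finset.univ.filter fun n => MvPolynomial.X n ∈ p.asIdeal
  have hI : ∀ n, n ∈ I ↔ (MvPolynomial.X n : D.CoordRing) ∈ p.asIdeal := fun n => by simp [I]
  have hcell : I.image CliffordDatum.Coord.val ∈ D.fan.cells := by
    obtain ⟨σ, hσ, hσp⟩ := hp
    refine D.fan.face_mem σ hσ _ fun n hn => ?_
    obtain ⟨m, hm, rfl⟩ := Finset.mem_image.1 hn
    rw [← Finset.mem_coe, hσp]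
    exact Or.inl ⟨m, (hI m).1 hm, rfl⟩
  have hne : ∀ i, ∃ m ∈ A i, ∀ n ∈ I, a m n = 0 := by
    intro i
    -- The `t_i` do not index coordinates, so none of them is in the cone of `I`.
    obtain ⟨m, hm, hmI⟩ := D.exists_mem_K1 hcell i fun h => by
      obtain ⟨n, -, hn⟩ := Finset.mem_image.1 h
      exact n.2.2 ⟨i, hn.symm⟩
    refine ⟨m, by simpa [A] using hm, fun n hn => ?_⟩
    simp only [a, hmI _ (Finset.mem_image_of_mem _ hn), Int.toNat_zero]
  obtain ⟨T, hTind, hTcard⟩ :=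
    MvPolynomial.exists_transcendenceBasis_variables p.asIdeal I fun n hn => (hI n).1 hn
  obtain ⟨e, he, hht⟩ := HasDimensionBound.mvPolynomial ℂ D.Coord p.asIdeal hprime
  have heT : e ≤ T.card := by
    rw [← hTcard] at he
    exact_mod_cast he
  have hTle : T.card + (k - r) ≤ Fintype.card {n // n ∉ I} := by
    by_contra hlt
    let B := D.CoordRing ⧸ p.asIdeal
    let L := FractionRing B
    have hLinj : Function.Injective (algebraMap B L) := IsFractionRing.injective B L
    -- The generic point of `V(p)`: a solution whose vanishing coordinates are exactly `I`, and
    -- whose coordinates `T` are algebraically independent.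
    let x : D.Coord → L := fun n => algebraMap B L (Ideal.Quotient.mk p.asIdeal (MvPolynomial.X n))
    refine hQ I T hne (not_le.1 hlt) c (hc' I T) L x (fun n => ?_) (fun i => ?_) ?_
    · rw [hI, ← Ideal.Quotient.eq_zero_iff_mem]
      exact map_eq_zero_iff _ hLinj
    · have h1 : algebraMap B L (Ideal.Quotient.mk p.asIdeal (D.f c i)) = 0 := by
        rw [Ideal.Quotient.eq_zero_iff_mem.2 (hfp i), map_zero]
      rw [← h1, CliffordDatum.f, map_sum, map_sum]
      refine Finset.sum_congr rfl fun m _ => ?_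
      simp only [map_mul, map_prod, map_pow]
      rfl
    · exact hTind.map' (f := IsScalarTower.toAlgHom ℂ B L) hLinj
  have hle : Fintype.card {n // n ∉ I} ≤ Nat.card D.Coord := by
    rw [Nat.card_eq_fintype_card]
    exact Fintype.card_subtype_le _
  -- Replacing the dimension of the orbit by that of the whole affine space loses `|I|`, which is
  -- not needed.
  have hfinal : ((T.card : ℕ∞) + (k - r : ℕ)) ≤ T.card + p.asIdeal.height := by
    calc ((T.card : ℕ∞) + (k - r : ℕ)) ≤ Nat.card D.Coord := by exact_mod_cast hTle.trans hle
      _ ≤ e + p.asIdeal.height := hht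
      _ ≤ _ := by gcongr
  exact (ENat.add_le_add_iff_left (ENat.natCast_ne_top _)).1 hfinal
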